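/- For a finite connected graph $G$ with graph distance $\operatorname{d}$, a $3$-term arithmetic progression ($3$-AP) in $G$ is a set of three distinct vertices that can be listed as $v_1,v_2,v_3$ with $\operatorname{d}(v_1,v_2)=\operatorname{d}(v_2,v_3)$. An exact $r$-coloring of $G$ is a surjective map $c:V(G)\to\{1,\dots,r\}$, and a $3$-AP is rainbow under $c$ if its three vertices have pairwise distinct colors. The anti-van der Waerden number $\operatorname{aw}(G,3)$ is the least positive integer $r$ such that every exact $r$-coloring of $G$ contains a rainbow $3$-AP (for $r>|V(G)|$ there is no exact $r$-coloring, so the condition holds vacuously). Let $P_n$ denote the path on $n$ vertices and $\square$ the Cartesian product of graphs. **Theorem.** For all integers $m,n\ge 2$, $$\operatorname{aw}(P_m\square P_n,3)=\begin{cases}3 & \text{if } \{m,n\}=\{2,k\} \text{ with } k \text{ even, or } \{m,n\}=\{3,k\} \text{ with } k \text{ odd},\\ 4 & \text{otherwise.}\end{cases}$$ That is, the value is $3$ if ($m=2$ and $n$ is even) or ($n=2$ and $m$ is even) or ($m=3$ and $n$ is odd) or ($n=3$ and $m$ is odd), and it is $4$ in every other case. -/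

import Mathlib

/-- A sequence `v` of `k` vertices of `G` is a `k`-term arithmetic progression if all pairs of
consecutive terms are at the same distance in `G`. Terms may be repeated (degenerate case). -/
def SimpleGraph.IsAP {V : Type*} (G : SimpleGraph V) {k : ℕ} (v : Fin k → V) : Prop :=
  ∃ d : ℕ, ∀ i j : Fin k, (i : ℕ) + 1 = (j : ℕ) → G.dist (v i) (v j) = d

/-- A set of vertices is rainbow under `c` if distinct vertices in it have distinct colors. -/
def SimpleGraph.IsRainbow {V C : Type*} (c : V → C) (S : Set V) : Prop :=
  ∀ u ∈ S, ∀ w ∈ S, u ≠ w → c u ≠ c w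

/-- The coloring `c` of the vertices of `G` has a rainbow `k`-AP: a set of `k` vertices, listed by
an injective `v`, which is an arithmetic progression and rainbow. Degenerate arithmetic
progressions are never counted as rainbow. -/
def SimpleGraph.HasRainbowAP {V C : Type*} (G : SimpleGraph V) (k : ℕ) (c : V → C) : Prop :=
  ∃ v : Fin k → V, Function.Injective v ∧ G.IsAP v ∧ SimpleGraph.IsRainbow c (Set.range v)

/-- The anti-van der Waerden number `aw(G, k)` of a finite connected graph: the least positive
integer `r` such that every exact (that is, surjective) `r`-coloring of the vertices of `G` has a
rainbow `k`-AP. For `r` greater than the number of vertices there is no exact `r`-coloring, so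
`aw(G, k)` is at most one more than the number of vertices. -/
noncomputable def SimpleGraph.aw {V : Type*} (G : SimpleGraph V) (k : ℕ) : ℕ :=
  sInf {r : ℕ | 0 < r ∧ ∀ c : V → Fin r, Function.Surjective c → G.HasRainbowAP k c}

/-! Graph distance in the grid is `ℓ¹` distance, and the `ℓ¹` perimeter of a triple is twice the
semiperimeter of its bounding box. In a rainbow-free colouring with at least three colours, take a
rainbow triple of least perimeter. Replacing a vertex by the coordinatewise median shows that one
vertex lies in the box spanned by the other two (`PerimeterBound.exists_between`). Minimality makes
this box monochromatic except at those two corners, coloured `R` and `B` (`Corners.color_eq`).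
Rainbow-freeness makes their distance odd and lets each corner slide along its whole antidiagonal
(`ExtremalBox.slide`). So, up to a reflection, the colouring is `Banded`: an `R` antidiagonal, a `B`
antidiagonal, only `W` between them, at an odd distance exceeding `M` and `N`.

Equidistance then forbids a fourth colour beyond the bands (`Banded.color`), so the value is at most
4. In the exceptional grids the band itself is impossible, by parity or by one explicit progression.
In all others `bandColoring` is an exact rainbow-free 3-colouring. -/

/-- The point `(x, y)` lies in the grid `[0, M] × [0, N]`. -/
abbrev InGrid (M N x y : ℤ) : Prop := 0 ≤ x ∧ x ≤ M ∧ 0 ≤ y ∧ y ≤ N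

/-- The colouring `c` of the grid `[0, M] × [0, N]` has no rainbow `3`-AP for the `ℓ¹` metric. -/
def RainbowFree {C : Type*} (c : ℤ → ℤ → C) (M N : ℤ) : Prop :=
  ∀ a b p q x y : ℤ, InGrid M N a b → InGrid M N p q → InGrid M N x y →
    (a - p).natAbs + (b - q).natAbs = (p - x).natAbs + (q - y).natAbs →
    c a b ≠ c p q → c p q ≠ c x y → c a b ≠ c x y → False

/-- Every rainbow triple of grid points has `ℓ¹`-perimeter at least `2 * s`. -/
def PerimeterBound {C : Type*} (c : ℤ → ℤ → C) (M N : ℤ) (s : ℕ) : Prop :=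
  ∀ a b p q x y : ℤ, InGrid M N a b → InGrid M N p q → InGrid M N x y →
    c a b ≠ c p q → c p q ≠ c x y → c a b ≠ c x y →
    2 * s ≤ ((a - p).natAbs + (b - q).natAbs) + ((p - x).natAbs + (q - y).natAbs)
      + ((a - x).natAbs + (b - y).natAbs)

/-! ### Symmetries of the grid -/

section Symmetry

variable {C : Type*} {c : ℤ → ℤ → C} {M N : ℤ} {s : ℕ}

lemma RainbowFree.transpose (h : RainbowFree c M N) : RainbowFree (fun x y => c y x) N M := by
  intro a b p q x y h1 h2 h3 hd
  exact h b a q p y x (by omega) (by omega) (by omega) (by omega)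

lemma RainbowFree.rotate (h : RainbowFree c M N) :
    RainbowFree (fun x y => c (M - x) (N - y)) M N := by
  intro a b p q x y h1 h2 h3 hd
  exact h _ _ _ _ _ _ (by omega) (by omega) (by omega) (by omega)

lemma RainbowFree.flip (h : RainbowFree c M N) : RainbowFree (fun x y => c x (N - y)) M N := by
  intro a b p q x y h1 h2 h3 hd
  exact h _ _ _ _ _ _ (by omega) (by omega) (by omega) (by omega)

lemma PerimeterBound.transpose (h : PerimeterBound c M N s) :
    PerimeterBound (fun x y => c y x) N M s := by
  intro a b p q x y h1 h2 h3 e1 e2 e3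
  have := h b a q p y x (by omega) (by omega) (by omega) e1 e2 e3
  omega

lemma PerimeterBound.rotate (h : PerimeterBound c M N s) :
    PerimeterBound (fun x y => c (M - x) (N - y)) M N s := by
  intro a b p q x y h1 h2 h3 e1 e2 e3
  have := h _ _ _ _ _ _ (by omega) (by omega) (by omega) e1 e2 e3
  rw [show M - a - (M - p) = -(a - p) by ring, show N - b - (N - q) = -(b - q) by ring,
    show M - p - (M - x) = -(p - x) by ring, show N - q - (N - y) = -(q - y) by ring,
    show M - a - (M - x) = -(a - x) by ring, show N - b - (N - y) = -(b - y) by ring] at this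
  simpa only [Int.natAbs_neg] using this

lemma PerimeterBound.flip (h : PerimeterBound c M N s) :
    PerimeterBound (fun x y => c x (N - y)) M N s := by
  intro a b p q x y h1 h2 h3 e1 e2 e3
  have := h _ _ _ _ _ _ (by omega) (by omega) (by omega) e1 e2 e3
  rw [show N - b - (N - q) = -(b - q) by ring, show N - q - (N - y) = -(q - y) by ring,
    show N - b - (N - y) = -(b - y) by ring] at this
  simpa only [Int.natAbs_neg] using this

end Symmetry

/-! ### The box spanned by a rainbow triple of least perimeter -/

/-- A rainbow-free colouring of a grid with at least two rows and columns, a lower bound `2 * s`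
for the perimeters of rainbow triples, and three different colours. -/
structure Setting {C : Type*} (c : ℤ → ℤ → C) (M N : ℤ) (s : ℕ) (R B W : C) : Prop where
  hM : 1 ≤ M
  hN : 1 ≤ N
  free : RainbowFree c M N
  bound : PerimeterBound c M N s
  rb : R ≠ B
  rw : R ≠ W
  bw : B ≠ W

/-- The points `(a, b) ≤ (p, q)` of the grid at distance `s` have colours `R` and `B`. -/
structure Corners {C : Type*} (c : ℤ → ℤ → C) (M N : ℤ) (s : ℕ) (R B : C) (a b p q : ℤ) :
    Prop where
  a0 : 0 ≤ a
  b0 : 0 ≤ b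
  ap : a ≤ p
  bq : b ≤ q
  pM : p ≤ M
  qN : q ≤ N
  dist : (p - a) + (q - b) = s
  cu : c a b = R
  cv : c p q = B

section

variable {C : Type*} {c : ℤ → ℤ → C} {M N : ℤ} {s : ℕ} {R B W : C} {a b p q : ℤ}

lemma Setting.transpose (h : Setting c M N s R B W) :
    Setting (fun x y => c y x) N M s R B W :=
  ⟨h.hN, h.hM, h.free.transpose, h.bound.transpose, h.rb, h.rw, h.bw⟩

lemma Setting.rotate (h : Setting c M N s R B W) :
    Setting (fun x y => c (M - x) (N - y)) M N s B R W :=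
  ⟨h.hM, h.hN, h.free.rotate, h.bound.rotate, h.rb.symm, h.bw, h.rw⟩

lemma Corners.transpose (h : Corners c M N s R B a b p q) :
    Corners (fun x y => c y x) N M s R B b a q p :=
  ⟨h.b0, h.a0, h.bq, h.ap, h.qN, h.pM, by linarith [h.dist], h.cu, h.cv⟩

lemma Corners.rotate (h : Corners c M N s R B a b p q) :
    Corners (fun x y => c (M - x) (N - y)) M N s B R (M - p) (N - q) (M - a) (N - b) := by
  obtain ⟨h1, h2, h3, h4, h5, h6, h7, h8, h9⟩ := h
  refine ⟨by omega, by omega, by omega, by omega, by omega, by omega, by omega, ?_, ?_⟩ <;>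
    simpa only [sub_sub_cancel]

/-- The antipodal corners of the box cannot carry `W` and a colour other than `B` and `W`. -/
lemma Corners.antipodal_false (hS : Setting c M N s R B W) (h : Corners c M N s R B a b p q)
    (ap : a < p) (bq : b < q) (hw : c a q = W) (hzB : c p b ≠ B) (hzW : c p b ≠ W) : False := by
  obtain ⟨a0, b0, -, -, pM, qN, hd, cu, cv⟩ := h
  have hmin := hS.bound
  have rb := hS.rb
  have rw := hS.rw
  have bw := hS.bw
  by_cases hq : b + 2 ≤ q
  -- Any other colour gives a rainbow triple whose bounding box is strictly smaller than the whole
  -- box; the later forced colours arise likewise.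
  · have e1 : c a (b + 1) = W := by
      by_contra hne
      by_cases hR : c a (b + 1) = R
      · have := hmin a (b + 1) a q p q (by omega) (by omega) (by omega) (by simp_all)
          (by simp_all [ne_comm]) (by simp_all)
        omega
      · have := hmin a b a (b + 1) a q (by omega) (by omega) (by omega) (by simp_all [ne_comm])
          (by simp_all) (by simp_all)
        omega
    have e2 : c p (b + 1) = B := by
      by_contra hne
      by_cases hR : c p (b + 1) = c p b
      · have := hmin p (b + 1) a q p q (by omega) (by omega) (by omega) (by simp_all)
          (by simp_all [ne_comm]) (by simp_all)
        omega
      · have := hmin p b p (b + 1) p q (by omega) (by omega) (by omega) (by simp_all [ne_comm])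
          (by simp_all) (by simp_all)
        omega
    have := hmin a b a (b + 1) p (b + 1) (by omega) (by omega) (by omega) (by simp_all)
      (by simp_all [ne_comm]) (by simp_all)
    omega
  by_cases hp : a + 2 ≤ p
  · have e1 : c (a + 1) q = B := by
      by_contra hne
      by_cases hR : c (a + 1) q = W
      · have := hmin (a + 1) q p q p b (by omega) (by omega) (by omega) (by simp_all [ne_comm])
          (by simp_all [ne_comm]) (by simp_all [ne_comm])
        omega
      · have := hmin a q (a + 1) q p q (by omega) (by omega) (by omega) (by simp_all [ne_comm])
          (by simp_all) (by simp_all [ne_comm])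
        omega
    have := hmin a b a q (a + 1) q (by omega) (by omega) (by omega) (by simp_all)
      (by simp_all [ne_comm]) (by simp_all)
    omega
  -- Only the unit square is left, where perimeter gives nothing but three corners form a
  -- progression.
  exact hS.free a q p q p b (by omega) (by omega) (by omega) (by omega) (by simp_all [ne_comm])
    (by simp_all [ne_comm]) (by simp_all [ne_comm])

/-- A second vertex coloured `R` on one edge of the box and `W` on the other edge at the same
corner must be the antipodal corners. -/
lemma Corners.edge_eq (hS : Setting c M N s R B W) (h : Corners c M N s R B a b p q)
    {x y : ℤ} (hx : a < x) (hxp : x ≤ p) (hy : b < y) (hyq : y ≤ q)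
    (hz : c x b = R) (hw : c a y = W) : x = p ∧ y = q := by
  obtain ⟨a0, b0, -, -, pM, qN, hd, cu, cv⟩ := h
  have hmin := hS.bound
  have rb := hS.rb
  have rw := hS.rw
  have bw := hS.bw
  by_contra hne
  -- No colour is possible at `(x, y)`: each one completes a rainbow triple with too small a
  -- bounding box.
  by_cases h1 : c x y = R
  · have := hmin x y a y p q (by omega) (by omega) (by omega) (by simp_all)
      (by simp_all [ne_comm]) (by simp_all)
    omega
  by_cases h2 : c x y = W
  · have := hmin x b x y p q (by omega) (by omega) (by omega) (by simp_all)
      (by simp_all [ne_comm]) (by simp_all)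
    omega
  have := hmin a b a y x y (by omega) (by omega) (by omega) (by simp_all)
    (by simp_all [ne_comm]) (by simp_all [ne_comm])
  omega

/-- A point of any other colour forms with `(i, j)` and an outer corner a rainbow triple inside the
box. Minimality makes its bounding box the whole box, which pushes the two points to antipodal
corners. -/
lemma Corners.color_eq_or (hS : Setting c M N s R B W) (h : Corners c M N s R B a b p q)
    {i j x y : ℤ} (hai : a ≤ i) (hip : i ≤ p) (hbj : b ≤ j) (hjq : j ≤ q) (hw : c i j = W)
    (hax : a ≤ x) (hxp : x ≤ p) (hby : b ≤ y) (hyq : y ≤ q) (hu : x ≠ a ∨ y ≠ b) :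
    c x y = B ∨ c x y = W := by
  have rb := hS.rb
  have rw := hS.rw
  have bw := hS.bw
  have hmin := hS.bound
  by_contra hcon
  push Not at hcon
  obtain ⟨hB, hW⟩ := hcon
  obtain ⟨a0, b0, ap, bq, pM, qN, hd, cu, cv⟩ := id h
  have hiu : i ≠ a ∨ j ≠ b := by
    by_contra hcon
    push Not at hcon
    rw [hcon.1, hcon.2, cu] at hw
    exact rw hw
  have key : (x = p ∧ y = b ∧ i = a ∧ j = q) ∨ (x = a ∧ y = q ∧ i = p ∧ j = b) := by
    by_cases hR : c x y = R
    · have h1 := hmin x y i j p q (by omega) (by omega) (by omega) (by simp_all)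
        (by simp_all [ne_comm]) (by simp_all)
      have h2 : (y = b ∧ i = a) ∨ (x = a ∧ j = b) := by omega
      rcases h2 with ⟨rfl, rfl⟩ | ⟨rfl, rfl⟩
      · have := h.edge_eq hS (x := x) (y := j) (by omega) hxp (by omega) hjq hR hw
        omega
      · have := h.transpose.edge_eq hS.transpose (x := y) (y := i) (by omega) hyq (by omega)
          hip hR hw
        omega
    · have h1 := hmin a b x y i j (by omega) (by omega) (by omega) (by simp_all [ne_comm])
        (by simp_all [ne_comm]) (by simp_all [ne_comm])
      have h2 := hmin x y i j p q (by omega) (by omega) (by omega) (by simp_all)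
        (by simp_all [ne_comm]) (by simp_all)
      have h3 : s ≤ (x - i).natAbs + (y - j).natAbs := by
        generalize (x - i).natAbs + (y - j).natAbs = D at h1 h2
        omega
      clear h1 h2
      omega
  rcases key with ⟨rfl, rfl, rfl, rfl⟩ | ⟨rfl, rfl, rfl, rfl⟩
  · exact h.antipodal_false hS (by omega) (by omega) hw hB hW
  · exact h.transpose.antipodal_false hS.transpose (by omega) (by omega) hw hB hW

/-- A box spanned by a rainbow triple of least perimeter is monochromatic except for two
opposite corners. -/
lemma Corners.color_eq (hS : Setting c M N s R B W) (h : Corners c M N s R B a b p q)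
    {i j x y : ℤ} (hai : a ≤ i) (hip : i ≤ p) (hbj : b ≤ j) (hjq : j ≤ q) (hw : c i j = W)
    (hax : a ≤ x) (hxp : x ≤ p) (hby : b ≤ y) (hyq : y ≤ q) (hu : x ≠ a ∨ y ≠ b)
    (hv : x ≠ p ∨ y ≠ q) : c x y = W := by
  have h1 := h.color_eq_or hS hai hip hbj hjq hw hax hxp hby hyq hu
  have h2 := h.rotate.color_eq_or hS.rotate (i := M - i) (j := N - j) (x := M - x) (y := N - y)
    (by omega) (by omega) (by omega) (by omega) (by simpa only [sub_sub_cancel])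
    (by omega) (by omega) (by omega) (by omega) (by omega)
  simp only [sub_sub_cancel] at h2
  have := hS.rb
  rcases h1 with h1 | h1
  · rcases h2 with h2 | h2
    · exact absurd (h2.symm.trans h1) this
    · exact h2
  · exact h1

end

/-! ### Extremal boxes and sliding their corners -/

/-- A rainbow triple of least perimeter whose outer vertices are `(a, b) ≤ (p, q)`: the box
between them has colour `W` inside. -/
structure ExtremalBox {C : Type*} (c : ℤ → ℤ → C) (M N : ℤ) (s : ℕ) (R B W : C) (a b p q : ℤ) :
    Prop extends Corners c M N s R B a b p q where
  two_le : 2 ≤ s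
  mid : ∀ x y, a ≤ x → x ≤ p → b ≤ y → y ≤ q → (x ≠ a ∨ y ≠ b) → (x ≠ p ∨ y ≠ q) → c x y = W

section

variable {C : Type*} {c : ℤ → ℤ → C} {M N : ℤ} {s : ℕ} {R B W : C} {a b p q : ℤ}

lemma ExtremalBox.transpose (h : ExtremalBox c M N s R B W a b p q) :
    ExtremalBox (fun x y => c y x) N M s R B W b a q p :=
  ⟨h.toCorners.transpose, h.two_le, fun x y h1 h2 h3 h4 h5 h6 =>
    h.mid y x h3 h4 h1 h2 h5.symm h6.symm⟩

lemma ExtremalBox.rotate (h : ExtremalBox c M N s R B W a b p q) :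
    ExtremalBox (fun x y => c (M - x) (N - y)) M N s B R W (M - p) (N - q) (M - a) (N - b) :=
  ⟨h.toCorners.rotate, h.two_le, fun x y h1 h2 h3 h4 h5 h6 =>
    h.mid _ _ (by omega) (by omega) (by omega) (by omega) (by omega) (by omega)⟩

lemma Corners.extremalBox (hS : Setting c M N s R B W) (h : Corners c M N s R B a b p q)
    {i j : ℤ} (hai : a ≤ i) (hip : i ≤ p) (hbj : b ≤ j) (hjq : j ≤ q) (hw : c i j = W) :
    ExtremalBox c M N s R B W a b p q := by
  have h1 : i ≠ a ∨ j ≠ b := by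
    by_contra hcon
    push Not at hcon
    rw [hcon.1, hcon.2, h.cu] at hw
    exact hS.rw hw
  have h2 : i ≠ p ∨ j ≠ q := by
    by_contra hcon
    push Not at hcon
    rw [hcon.1, hcon.2, h.cv] at hw
    exact hS.bw hw
  have hd := h.dist
  exact ⟨h, by omega, fun x y h3 h4 h5 h6 => h.color_eq hS hai hip hbj hjq hw h3 h4 h5 h6⟩

/-- For even `s`, a point of the box halfway between the outer corners has colour `W` and completes
a rainbow progression. -/
lemma ExtremalBox.odd (hS : Setting c M N s R B W) (h : ExtremalBox c M N s R B W a b p q) :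
    Odd s := by
  by_contra hs
  obtain ⟨k, hk⟩ := Nat.not_odd_iff_even.mp hs
  obtain ⟨⟨a0, b0, ap, bq, pM, qN, hd, cu, cv⟩, h2, mid⟩ := h
  have hx : ∃ x y : ℤ, a ≤ x ∧ x ≤ p ∧ b ≤ y ∧ y ≤ q ∧ (x - a) + (y - b) = k :=
    ⟨min p (a + k), b + k - (min p (a + k) - a), by omega, by omega, by omega, by omega, by omega⟩
  obtain ⟨x, y, h3, h4, h5, h6, h7⟩ := hx
  have hw := mid x y h3 h4 h5 h6 (by omega) (by omega)
  exact hS.free a b x y p q (by omega) (by omega) (by omega) (by omega)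
    (by rw [cu, hw]; exact hS.rw) (by rw [hw, cv]; exact hS.bw.symm)
    (by rw [cu, cv]; exact hS.rb)

lemma ExtremalBox.three_le (hS : Setting c M N s R B W) (h : ExtremalBox c M N s R B W a b p q) :
    3 ≤ s := by
  obtain ⟨k, hk⟩ := h.odd hS
  have := h.two_le
  omega

/-- If the box were a segment, a neighbouring row would be forced to contain an `R` and a `B` two
steps closer together, and a `W` next to that `R` would give a smaller perimeter. -/
lemma ExtremalBox.snd_lt (hS : Setting c M N s R B W) (h : ExtremalBox c M N s R B W a b p q) :
    b < q := by
  have h3 := h.three_le hS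
  have hN := hS.hN
  obtain ⟨⟨a0, b0, ap, bq, pM, qN, hd, cu, cv⟩, h2, mid⟩ := h
  by_contra hq
  obtain rfl : b = q := by omega
  have hy : ∃ y, 0 ≤ y ∧ y ≤ N ∧ (b - y).natAbs = 1 := by
    by_cases hb : b = 0
    · exact ⟨1, by omega, by omega, by omega⟩
    · exact ⟨b - 1, by omega, by omega, by omega⟩
  obtain ⟨y, y0, yN, hy⟩ := hy
  have hy' : (y - b).natAbs = 1 := by omega
  have rb := hS.rb
  have rw := hS.rw
  have bw := hS.bw
  have w1 := mid (p - 1) b (by omega) (by omega) (by omega) (by omega) (by omega) (by omega)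
  have w2 := mid (a + 1) b (by omega) (by omega) (by omega) (by omega) (by omega) (by omega)
  have e1 : c (p - 1) y = B := by
    by_contra hB
    by_cases hR : c (p - 1) y = R
    · have := hS.bound (p - 1) y p b (p - 1) b (by omega) (by omega) (by omega) (by simp_all)
        (by simp_all) (by simp_all)
      omega
    -- Moving one step in and one step sideways keeps the distance `s` from `(a, b)`.
    · exact hS.free p b a b (p - 1) y (by omega) (by omega) (by omega) (by omega)
        (by simp_all [ne_comm]) (by simp_all [ne_comm]) (by simp_all [ne_comm])
  have e2 : c (a + 1) y = R := by
    by_contra hR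
    by_cases hB : c (a + 1) y = B
    · have := hS.bound (a + 1) y a b (a + 1) b (by omega) (by omega) (by omega)
        (by simp_all [ne_comm]) (by simp_all) (by simp_all)
      omega
    · exact hS.free a b p b (a + 1) y (by omega) (by omega) (by omega) (by omega)
        (by simp_all [ne_comm]) (by simp_all [ne_comm]) (by simp_all [ne_comm])
  have := hS.bound (a + 1) y (p - 1) y (a + 1) b (by omega) (by omega) (by omega)
    (by simp_all) (by simp_all) (by simp_all)
  omega

lemma ExtremalBox.fst_lt (hS : Setting c M N s R B W) (h : ExtremalBox c M N s R B W a b p q) :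
    a < p :=
  h.transpose.snd_lt hS.transpose

/-- The upper corner of an extremal box can be moved along its antidiagonal. -/
lemma ExtremalBox.slide (hS : Setting c M N s R B W) (h : ExtremalBox c M N s R B W a b p q)
    (hp : p + 1 ≤ M) : ExtremalBox c M N s R B W a b (p + 1) (q - 1) := by
  have h3 := h.three_le hS
  have bq := h.snd_lt hS
  have ap := h.fst_lt hS
  obtain ⟨⟨a0, b0, -, -, pM, qN, hd, cu, cv⟩, h2, mid⟩ := h
  have rb := hS.rb
  have rw := hS.rw
  have bw := hS.bw
  have w := mid p (q - 1) (by omega) (by omega) (by omega) (by omega) (by omega) (by omega)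
  have e : c (p + 1) (q - 1) = B := by
    by_contra hB
    by_cases hR : c (p + 1) (q - 1) = R
    · have := hS.bound (p + 1) (q - 1) p q p (q - 1) (by omega) (by omega) (by omega)
        (by simp_all) (by simp_all) (by simp_all)
      omega
    -- Both upper points are at distance `s` from `(a, b)`.
    · exact hS.free p q a b (p + 1) (q - 1) (by omega) (by omega) (by omega) (by omega)
        (by simp_all [ne_comm]) (by simp_all [ne_comm]) (by simp_all [ne_comm])
  exact Corners.extremalBox hS
    ⟨a0, b0, by omega, by omega, hp, by omega, by omega, cu, e⟩ (i := p) (j := q - 1)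
    (by omega) (by omega) (by omega) (by omega) w

lemma ExtremalBox.slide_add (hS : Setting c M N s R B W) (h : ExtremalBox c M N s R B W a b p q)
    (k : ℕ) (hp : p + k ≤ M) : ExtremalBox c M N s R B W a b (p + k) (q - k) := by
  induction k with
  | zero => simpa using h
  | succ k ih =>
    have := (ih (by omega)).slide hS (by omega)
    convert this using 1 <;> push_cast <;> ring

/-- No lower bounds on `x` and `y` are needed: each slide yields an extremal box, which is never
degenerate, so the upper corner cannot pass the lower one. -/
lemma ExtremalBox.move_upper (hS : Setting c M N s R B W)
    (h : ExtremalBox c M N s R B W a b p q) {x y : ℤ} (hx : x ≤ M) (hy : y ≤ N)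
    (hxy : x + y = p + q) : ExtremalBox c M N s R B W a b x y := by
  rcases le_total p x with hpx | hpx
  · have := h.slide_add hS (x - p).toNat (by omega)
    convert this using 1 <;> omega
  · have := (h.transpose.slide_add hS.transpose (p - x).toNat (by omega)).transpose
    convert this using 1 <;> omega

lemma ExtremalBox.move_lower (hS : Setting c M N s R B W)
    (h : ExtremalBox c M N s R B W a b p q) {x y : ℤ} (hx : 0 ≤ x) (hy : 0 ≤ y)
    (hxy : x + y = a + b) : ExtremalBox c M N s R B W x y p q := by
  have := (h.rotate.move_upper hS.rotate (x := M - x) (y := N - y) (by omega) (by omega)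
    (by omega)).rotate
  simpa only [sub_sub_cancel] using this

end

/-! ### Banded colourings -/

/-- Two antidiagonals `x + y = α` and `x + y = β` near opposite corners of the grid have colours
`R` and `B`, and everything strictly between them has colour `W`. -/
structure Banded {C : Type*} (c : ℤ → ℤ → C) (M N α β : ℤ) (R B W : C) : Prop where
  rb : R ≠ B
  rw : R ≠ W
  bw : B ≠ W
  α0 : 0 ≤ α
  hβ : β ≤ M + N
  hM : M < β - α
  hN : N < β - α
  odd : Odd (β - α)
  free : RainbowFree c M N
  lower : ∀ x y, InGrid M N x y → x + y = α → c x y = R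
  upper : ∀ x y, InGrid M N x y → x + y = β → c x y = B
  mid : ∀ x y, InGrid M N x y → α < x + y → x + y < β → c x y = W

section

variable {C : Type*} {c : ℤ → ℤ → C} {M N α β : ℤ} {s : ℕ} {R B W : C} {a b p q : ℤ}

lemma ExtremalBox.banded (hS : Setting c M N s R B W) (h : ExtremalBox c M N s R B W a b p q) :
    Banded c M N (a + b) (p + q) R B W := by
  have hd := h.dist
  have a0 := h.a0
  have b0 := h.b0
  have pM := h.pM
  have qN := h.qN
  have hM := hS.hM
  have hN := hS.hN
  -- Slide the corners to the columns `0` and `M`; the resulting box still has positive height,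
  -- which is `s - M`.
  have key1 : M < (s : ℤ) := by
    have := ((h.move_lower hS (x := 0) (y := a + b) (by omega) (by omega) (by omega)).move_upper
      hS (x := M) (y := p + q - M) (by omega) (by omega) (by omega)).snd_lt hS
    omega
  have key2 : N < (s : ℤ) := by
    have := ((h.move_lower hS (x := a + b) (y := 0) (by omega) (by omega) (by omega)).move_upper
      hS (x := p + q - N) (y := N) (by omega) (by omega) (by omega)).fst_lt hS
    omega
  refine ⟨hS.rb, hS.rw, hS.bw, by omega, by omega, by omega, by omega, ?_, hS.free, ?_, ?_, ?_⟩
  · obtain ⟨k, hk⟩ := h.odd hS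
    exact ⟨k, by omega⟩
  · intro x y hg hxy
    exact (h.move_lower hS (by omega) (by omega) hxy).cu
  · intro x y hg hxy
    exact (h.move_upper hS (by omega) (by omega) hxy).cv
  · intro x y hg h1 h2
    have := (h.move_lower hS (x := min x (a + b)) (y := a + b - min x (a + b)) (by omega)
      (by omega) (by omega)).move_upper hS (x := max x (p + q - N))
        (y := p + q - max x (p + q - N)) (by omega) (by omega) (by omega)
    exact this.mid x y (by omega) (by omega) (by omega) (by omega) (by omega) (by omega)

lemma Banded.rotate (h : Banded c M N α β R B W) :
    Banded (fun x y => c (M - x) (N - y)) M N (M + N - β) (M + N - α) B R W := by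
  obtain ⟨h1, h2, h3, h4, h5, h6, h7, h8, h9, h10, h11, h12⟩ := h
  refine ⟨h1.symm, h3, h2, by omega, by omega, by omega, by omega, ?_, h9.rotate, ?_, ?_, ?_⟩
  · convert h8 using 1
    ring
  · exact fun x y hg hxy => h11 _ _ (by omega) (by omega)
  · exact fun x y hg hxy => h10 _ _ (by omega) (by omega)
  · exact fun x y hg hx hy => h12 _ _ (by omega) (by omega) (by omega)

lemma Banded.transpose (h : Banded c M N α β R B W) :
    Banded (fun x y => c y x) N M α β R B W := by
  obtain ⟨h1, h2, h3, h4, h5, h6, h7, h8, h9, h10, h11, h12⟩ := h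
  exact ⟨h1, h2, h3, h4, by omega, h7, h6, h8, h9.transpose,
    fun x y hg hxy => h10 _ _ (by omega) (by omega),
    fun x y hg hxy => h11 _ _ (by omega) (by omega),
    fun x y hg hx hy => h12 _ _ (by omega) (by omega) (by omega)⟩

/-- The corner cut off by the lower antidiagonal contains no fourth colour. -/
lemma Banded.color_of_lt (h : Banded c M N α β R B W) {x y : ℤ} (hg : InGrid M N x y)
    (hxy : x + y < α) : c x y = R ∨ c x y = B ∨ c x y = W := by
  obtain ⟨rb, rw, bw, α0, hβ, hM, hN, ⟨k, hk⟩, free, lower, upper, mid⟩ := h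
  by_contra hcon
  push Not at hcon
  obtain ⟨hR, hB, hW⟩ := hcon
  obtain ⟨t, ht | ht⟩ := Int.even_or_odd' (β - (x + y))
  -- Even case: a midpoint between `(x, y)` and a `B` point above it has colour `R` or `W`.
  · have hv : ∃ p q : ℤ, x ≤ p ∧ p ≤ M ∧ y ≤ q ∧ q ≤ N ∧ p + q = β :=
      ⟨max x (β - N), β - max x (β - N), by omega, by omega, by omega, by omega, by omega⟩
    obtain ⟨p, q, h1, h2, h3, h4, h5⟩ := hv
    have hm : ∃ i j : ℤ, x ≤ i ∧ i ≤ p ∧ y ≤ j ∧ j ≤ q ∧ (i + j) = x + y + t :=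
      ⟨min p (x + t), x + y + t - min p (x + t), by omega, by omega, by omega, by omega, by omega⟩
    obtain ⟨i, j, h6, h7, h8, h9, h10⟩ := hm
    have cB := upper p q (by omega) h5
    have cm : c i j = R ∨ c i j = W := by
      rcases (show α ≤ i + j by omega).eq_or_lt with he | hlt
      · exact .inl (lower i j (by omega) he.symm)
      · exact .inr (mid i j (by omega) hlt (by omega))
    rcases cm with cm | cm
    · exact free x y i j p q (by omega) (by omega) (by omega) (by omega) (by rwa [cm])
        (by rwa [cm, cB]) (by rwa [cB])
    · exact free x y i j p q (by omega) (by omega) (by omega) (by omega) (by rwa [cm])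
        (by rw [cm, cB]; exact bw.symm) (by rwa [cB])
  -- Odd case: `α - (x + y)` is even because `β - α` is odd. The choice `2 * i = α + x + y` makes
  -- `(i, j)` equidistant from `(x, y)` and `(α, 0)` for every `j ≥ y`, so `j` is free to place the
  -- point in the `W` band.
  · have cR := lower α 0 (by omega) (by omega)
    have hm : ∃ i j : ℤ, x ≤ i ∧ i ≤ α ∧ y ≤ j ∧ j ≤ N ∧ α < i + j ∧ i + j < β ∧
        2 * i = α + x + y :=
      ⟨x + y + (t - k), max y (α - (x + y + (t - k)) + 1), by omega, by omega, by omega, by omega,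
        by omega, by omega, by omega⟩
    obtain ⟨i, j, h1, h2, h3, h4, h5, h6, h7⟩ := hm
    have cW := mid i j (by omega) h5 h6
    exact free x y i j α 0 (by omega) (by omega) (by omega) (by omega) (by rwa [cW])
      (by rw [cW, cR]; exact rw.symm) (by rwa [cR])

lemma Banded.color (h : Banded c M N α β R B W) {x y : ℤ} (hg : InGrid M N x y) :
    c x y = R ∨ c x y = B ∨ c x y = W := by
  rcases lt_trichotomy (x + y) α with h1 | h1 | h1
  · exact h.color_of_lt hg h1
  · exact .inl (h.lower x y hg h1)
  rcases lt_trichotomy (x + y) β with h2 | h2 | h2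
  · exact .inr (.inr (h.mid x y hg h1 h2))
  · exact .inr (.inl (h.upper x y hg h2))
  · have := h.rotate.color_of_lt (x := M - x) (y := N - y) (by omega) (by omega)
    simp only [sub_sub_cancel] at this
    tauto

/-- The bounds `N < β - α ≤ N + 1` force the even value `N + 1`. -/
lemma Banded.two_even_false (h : Banded c M N α β R B W) (hM : M = 1) (hN : Odd N) : False := by
  obtain ⟨k, hk⟩ := h.odd
  obtain ⟨l, hl⟩ := hN
  have := h.hM
  have := h.hN
  have := h.hβ
  have := h.α0
  omega

/-- The `B` point `(1, N)` is equidistant from the two corners `(0, 0)` and `(2, 0)`. -/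
lemma Banded.three_odd_lower_false (h : Banded c 2 N 0 (N + 1) R B W) : False := by
  have h1 := h.hM
  have cR := h.lower 0 0 (by omega) (by omega)
  have cB := h.upper 1 N (by omega) (by omega)
  have cW := h.mid 2 0 (by omega) (by omega) (by omega)
  exact h.free 0 0 1 N 2 0 (by omega) (by omega) (by omega) (by omega)
    (by rw [cR, cB]; exact h.rb) (by rw [cB, cW]; exact h.bw) (by rw [cR, cW]; exact h.rw)

lemma Banded.three_odd_false (h : Banded c M N α β R B W) (hM : M = 2) (hN : Even N) :
    False := by
  subst hM
  obtain ⟨k, hk⟩ := h.odd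
  obtain ⟨l, hl⟩ := hN
  have h1 := h.hM
  have h2 := h.hN
  have h3 := h.hβ
  have h4 := h.α0
  rcases (show (α = 0 ∧ β = N + 1) ∨ (α = 1 ∧ β = N + 2) by omega) with ⟨rfl, rfl⟩ | ⟨rfl, rfl⟩
  · exact h.three_odd_lower_false
  · have h' := h.rotate
    rw [show 2 + N - (N + 2) = 0 by ring, show 2 + N - 1 = N + 1 by ring] at h'
    exact h'.three_odd_lower_false

/-! ### Finding a rainbow triple of least perimeter -/

/-- A rainbow triple of least perimeter has one vertex between the other two. -/
lemma PerimeterBound.exists_between (hb : PerimeterBound c M N s) {x₁ y₁ x₂ y₂ x₃ y₃ : ℤ}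
    (h₁ : InGrid M N x₁ y₁) (h₂ : InGrid M N x₂ y₂) (h₃ : InGrid M N x₃ y₃)
    (e₁₂ : c x₁ y₁ ≠ c x₂ y₂) (e₂₃ : c x₂ y₂ ≠ c x₃ y₃) (e₁₃ : c x₁ y₁ ≠ c x₃ y₃)
    (hs : ((x₁ - x₂).natAbs + (y₁ - y₂).natAbs) + ((x₂ - x₃).natAbs + (y₂ - y₃).natAbs)
      + ((x₁ - x₃).natAbs + (y₁ - y₃).natAbs) ≤ 2 * s) :
    ∃ a b p q i j : ℤ, InGrid M N a b ∧ InGrid M N p q ∧ InGrid M N i j ∧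
      c a b ≠ c p q ∧ c a b ≠ c i j ∧ c p q ≠ c i j ∧
      (a - p).natAbs + (b - q).natAbs = s ∧
      min a p ≤ i ∧ i ≤ max a p ∧ min b q ≤ j ∧ j ≤ max b q := by
  -- The median `(u, v)` lies on a geodesic between any two of the points. Its colour differs from
  -- two of theirs, and those two with the median have perimeter twice their distance; minimality
  -- makes the third point the median.
  obtain ⟨u, hu⟩ : ∃ u, u = max (min x₁ x₂) (min (max x₁ x₂) x₃) := ⟨_, rfl⟩
  obtain ⟨v, hv⟩ : ∃ v, v = max (min y₁ y₂) (min (max y₁ y₂) y₃) := ⟨_, rfl⟩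
  have hg : InGrid M N u v := by
    refine ⟨?_, ?_, ?_, ?_⟩ <;> omega
  have key : ∀ x₁ x₂ x₃ u : ℤ, u = max (min x₁ x₂) (min (max x₁ x₂) x₃) →
      (x₁ - x₂).natAbs = (x₁ - u).natAbs + (x₂ - u).natAbs ∧
      (x₂ - x₃).natAbs = (x₂ - u).natAbs + (x₃ - u).natAbs ∧
      (x₁ - x₃).natAbs = (x₁ - u).natAbs + (x₃ - u).natAbs := by
    intro x₁ x₂ x₃ u hu
    refine ⟨?_, ?_, ?_⟩ <;> omega
  obtain ⟨k1, k2, k3⟩ := key _ _ _ _ hu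
  obtain ⟨l1, l2, l3⟩ := key _ _ _ _ hv
  by_cases c1 : c u v = c x₁ y₁
  · have := hb x₂ y₂ x₃ y₃ u v h₂ h₃ hg e₂₃ (by rw [c1]; exact e₁₃.symm)
      (by rw [c1]; exact e₁₂.symm)
    have hz : (x₁ - u).natAbs = 0 ∧ (y₁ - v).natAbs = 0 := by omega
    obtain rfl : x₁ = u := by omega
    obtain rfl : y₁ = v := by omega
    exact ⟨x₂, y₂, x₃, y₃, x₁, y₁, h₂, h₃, h₁, e₂₃, e₁₂.symm, e₁₃.symm, by omega,
      by omega, by omega, by omega, by omega⟩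
  by_cases c2 : c u v = c x₂ y₂
  · have := hb x₁ y₁ x₃ y₃ u v h₁ h₃ hg e₁₃ (by rw [c2]; exact e₂₃.symm)
      (by rw [c2]; exact e₁₂)
    have hz : (x₂ - u).natAbs = 0 ∧ (y₂ - v).natAbs = 0 := by omega
    obtain rfl : x₂ = u := by omega
    obtain rfl : y₂ = v := by omega
    exact ⟨x₁, y₁, x₃, y₃, x₂, y₂, h₁, h₃, h₂, e₁₃, e₁₂, e₂₃.symm, by omega,
      by omega, by omega, by omega, by omega⟩
  · have := hb x₁ y₁ x₂ y₂ u v h₁ h₂ hg e₁₂ (Ne.symm c2) (Ne.symm c1)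
    have hz : (x₃ - u).natAbs = 0 ∧ (y₃ - v).natAbs = 0 := by omega
    obtain rfl : x₃ = u := by omega
    obtain rfl : y₃ = v := by omega
    exact ⟨x₁, y₁, x₂, y₂, x₃, y₃, h₁, h₂, h₃, e₁₂, e₁₃, e₂₃, by omega,
      by omega, by omega, by omega, by omega⟩

/-- Every rainbow-free colouring of a grid with at least three colours is banded, up to a
reflection. -/
lemma RainbowFree.exists_banded (h : RainbowFree c M N) (hM : 1 ≤ M) (hN : 1 ≤ N)
    {x₁ y₁ x₂ y₂ x₃ y₃ : ℤ}
    (h₁ : InGrid M N x₁ y₁) (h₂ : InGrid M N x₂ y₂) (h₃ : InGrid M N x₃ y₃)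
    (e₁₂ : c x₁ y₁ ≠ c x₂ y₂) (e₂₃ : c x₂ y₂ ≠ c x₃ y₃) (e₁₃ : c x₁ y₁ ≠ c x₃ y₃) :
    ∃ α β R B W, Banded c M N α β R B W ∨ Banded (fun x y => c x (N - y)) M N α β R B W := by
  classical
  have hex : ∃ s : ℕ, ∃ x₁ y₁ x₂ y₂ x₃ y₃ : ℤ, InGrid M N x₁ y₁ ∧ InGrid M N x₂ y₂ ∧
      InGrid M N x₃ y₃ ∧ c x₁ y₁ ≠ c x₂ y₂ ∧ c x₂ y₂ ≠ c x₃ y₃ ∧ c x₁ y₁ ≠ c x₃ y₃ ∧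
      ((x₁ - x₂).natAbs + (y₁ - y₂).natAbs) + ((x₂ - x₃).natAbs + (y₂ - y₃).natAbs)
      + ((x₁ - x₃).natAbs + (y₁ - y₃).natAbs) ≤ 2 * s :=
    ⟨_, x₁, y₁, x₂, y₂, x₃, y₃, h₁, h₂, h₃, e₁₂, e₂₃, e₁₃, Nat.le_mul_of_pos_left _ two_pos⟩
  obtain ⟨X₁, Y₁, X₂, Y₂, X₃, Y₃, g₁, g₂, g₃, f₁₂, f₂₃, f₁₃, hs⟩ := Nat.find_spec hex
  have hb : PerimeterBound c M N (Nat.find hex) := by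
    intro a b p q x y t₁ t₂ t₃ d₁ d₂ d₃
    -- Perimeters are even, so minimizing half of them loses nothing.
    have hpar : ∀ a p x : ℤ, ∃ k : ℕ,
        (a - p).natAbs + (p - x).natAbs + (a - x).natAbs = 2 * k := by
      intro a p x
      refine ⟨(max a (max p x) - min a (min p x)).natAbs, ?_⟩
      omega
    obtain ⟨k, hk⟩ := hpar a p x
    obtain ⟨l, hl⟩ := hpar b q y
    have := Nat.find_min' hex (m := k + l)
      ⟨a, b, p, q, x, y, t₁, t₂, t₃, d₁, d₂, d₃, by omega⟩
    omega
  obtain ⟨a, b, p, q, i, j, ga, gp, gi, n1, n2, n3, hd, i1, i2, j1, j2⟩ :=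
    hb.exists_between g₁ g₂ g₃ f₁₂ f₂₃ f₁₃ hs
  clear hs g₁ g₂ g₃ f₁₂ f₂₃ f₁₃
  generalize Nat.find hex = s at hb hd
  wlog hap : a ≤ p generalizing a b p q
  · exact this p q a b gp ga n1.symm n3 n2 (by omega) (by omega) (by omega) (by omega) (by omega)
      (by omega)
  rcases le_total b q with hbq | hbq
  · have hS : Setting c M N s (c a b) (c p q) (c i j) := ⟨hM, hN, h, hb, n1, n2, n3⟩
    have hC : Corners c M N s (c a b) (c p q) a b p q :=
      ⟨by omega, by omega, hap, hbq, by omega, by omega, by omega, rfl, rfl⟩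
    exact ⟨_, _, _, _, _, .inl ((hC.extremalBox hS (i := i) (j := j) (by omega) (by omega)
      (by omega) (by omega) rfl).banded hS)⟩
  · have hS : Setting (fun x y => c x (N - y)) M N s (c a b) (c p q) (c i j) :=
      ⟨hM, hN, h.flip, hb.flip, n1, n2, n3⟩
    have hC : Corners (fun x y => c x (N - y)) M N s (c a b) (c p q) a (N - b) p (N - q) :=
      ⟨by omega, by omega, hap, by omega, by omega, by omega, by omega,
        by simp only [sub_sub_cancel], by simp only [sub_sub_cancel]⟩
    exact ⟨_, _, _, _, _, .inr ((hC.extremalBox hS (i := i) (j := N - j) (by omega) (by omega)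
      (by omega) (by omega) (by simp only [sub_sub_cancel])).banded hS)⟩

end

/-! ### From products of paths to the integer grid -/

lemma SimpleGraph.hasRainbowAP_three_iff {V C : Type*} (G : SimpleGraph V) (c : V → C) :
    G.HasRainbowAP 3 c ↔ ∃ u v w : V, G.dist u v = G.dist v w ∧
      c u ≠ c v ∧ c v ≠ c w ∧ c u ≠ c w := by
  constructor
  · rintro ⟨v, hinj, ⟨d, hd⟩, hr⟩
    have hne : ∀ i j : Fin 3, i ≠ j → c (v i) ≠ c (v j) := fun i j hij =>
      hr _ ⟨i, rfl⟩ _ ⟨j, rfl⟩ (hinj.ne hij)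
    exact ⟨v 0, v 1, v 2, (hd 0 1 rfl).trans (hd 1 2 rfl).symm, hne _ _ (by decide),
      hne _ _ (by decide), hne _ _ (by decide)⟩
  · rintro ⟨u, v, w, hd, h1, h2, h3⟩
    have hne : ∀ i j : Fin 3, i ≠ j → c (![u, v, w] i) ≠ c (![u, v, w] j) := by
      intro i j hij
      fin_cases i <;> fin_cases j <;> simp_all [ne_comm]
    refine ⟨![u, v, w], ?_, ⟨G.dist u v, ?_⟩, ?_⟩
    · intro i j hij
      by_contra hcon
      exact hne i j hcon (congrArg c hij)
    · intro i j hij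
      fin_cases i <;> fin_cases j <;> simp_all
    · rintro _ ⟨i, rfl⟩ _ ⟨j, rfl⟩ hij
      exact hne i j fun h => hij (by rw [h])

lemma SimpleGraph.natAbs_le_length_pathGraph {n : ℕ} {u v : Fin n} (w : (pathGraph n).Walk u v) :
    ((u : ℤ) - v).natAbs ≤ w.length := by
  induction w with
  | nil => simp
  | cons h p ih =>
    rw [pathGraph_adj] at h
    rw [Walk.length_cons]
    omega

lemma SimpleGraph.exists_walk_pathGraph {n : ℕ} (k : ℕ) (u v : Fin n) (h : (u : ℕ) + k = v) :
    ∃ w : (pathGraph n).Walk u v, w.length = k := by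
  induction k generalizing u with
  | zero =>
    obtain rfl : u = v := Fin.ext h
    exact ⟨.nil, rfl⟩
  | succ k ih =>
    obtain ⟨w, hw⟩ := ih ⟨u + 1, by omega⟩ (by simp only; omega)
    exact ⟨.cons (pathGraph_adj.mpr (.inl rfl)) w, by rw [Walk.length_cons, hw]⟩

lemma SimpleGraph.dist_pathGraph {n : ℕ} (u v : Fin n) :
    (pathGraph n).dist u v = ((u : ℤ) - v).natAbs := by
  wlog h : u ≤ v generalizing u v
  · rw [dist_comm, this v u (le_of_not_ge h)]
    omega
  have h' : (u : ℕ) ≤ v := h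
  apply le_antisymm
  · obtain ⟨w, hw⟩ := exists_walk_pathGraph ((v : ℕ) - u) u v (by omega)
    exact (dist_le w).trans (by omega)
  · obtain ⟨w, hw⟩ := (pathGraph_preconnected n u v).exists_walk_length_eq_dist
    exact hw ▸ natAbs_le_length_pathGraph w

lemma SimpleGraph.dist_boxProd_pathGraph {m n : ℕ} (u v : Fin m × Fin n) :
    (pathGraph m □ pathGraph n).dist u v =
      ((u.1 : ℤ) - v.1).natAbs + ((u.2 : ℤ) - v.2).natAbs := by
  have h1 := (pathGraph_preconnected m u.1 v.1).coe_dist_eq_edist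
  have h2 := (pathGraph_preconnected n u.2 v.2).coe_dist_eq_edist
  rw [← dist_pathGraph, ← dist_pathGraph, SimpleGraph.dist, edist_boxProd, ← h1, ← h2]
  exact_mod_cast ENat.toNat_natCast _

/-- The integer point `(x, y)` clamped to the vertices of the grid. -/
def gridVertex {m n : ℕ} (hm : 0 < m) (hn : 0 < n) (x y : ℤ) : Fin m × Fin n :=
  (⟨min x.toNat (m - 1), by omega⟩, ⟨min y.toNat (n - 1), by omega⟩)

lemma gridVertex_coe {m n : ℕ} (hm : 0 < m) (hn : 0 < n) (u : Fin m × Fin n) :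
    gridVertex hm hn (u.1 : ℤ) (u.2 : ℤ) = u := by
  obtain ⟨⟨i, hi⟩, ⟨j, hj⟩⟩ := u
  simp only [gridVertex, Prod.mk.injEq, Fin.mk.injEq]
  omega

lemma gridVertex_fst {m n : ℕ} (hm : 0 < m) (hn : 0 < n) {x y : ℤ}
    (h : InGrid ((m : ℤ) - 1) ((n : ℤ) - 1) x y) :
    (((gridVertex hm hn x y).1 : ℕ) : ℤ) = x := by
  simp only [gridVertex]
  omega

lemma gridVertex_snd {m n : ℕ} (hm : 0 < m) (hn : 0 < n) {x y : ℤ}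
    (h : InGrid ((m : ℤ) - 1) ((n : ℤ) - 1) x y) :
    (((gridVertex hm hn x y).2 : ℕ) : ℤ) = y := by
  simp only [gridVertex]
  omega

lemma inGrid_coe {m n : ℕ} (u : Fin m × Fin n) :
    InGrid ((m : ℤ) - 1) ((n : ℤ) - 1) (u.1 : ℤ) (u.2 : ℤ) := by
  have := u.1.isLt
  have := u.2.isLt
  refine ⟨?_, ?_, ?_, ?_⟩ <;> omega

lemma rainbowFree_gridVertex {m n : ℕ} (hm : 0 < m) (hn : 0 < n) {C : Type*}
    {c : Fin m × Fin n → C}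
    (h : ¬ (SimpleGraph.pathGraph m □ SimpleGraph.pathGraph n).HasRainbowAP 3 c) :
    RainbowFree (fun x y => c (gridVertex hm hn x y)) ((m : ℤ) - 1) ((n : ℤ) - 1) := by
  intro a b p q x y h1 h2 h3 hd e1 e2 e3
  refine h ((SimpleGraph.hasRainbowAP_three_iff _ _).mpr ⟨_, _, _, ?_, e1, e2, e3⟩)
  simp only [SimpleGraph.dist_boxProd_pathGraph, gridVertex_fst hm hn h1, gridVertex_fst hm hn h2,
    gridVertex_fst hm hn h3, gridVertex_snd hm hn h1, gridVertex_snd hm hn h2,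
    gridVertex_snd hm hn h3, hd]

/-- A colouring without rainbow `3`-AP and with at least three colours is banded in integer
coordinates. -/
lemma exists_banded_of_not_hasRainbowAP {m n r : ℕ} (hm : 2 ≤ m) (hn : 2 ≤ n) (hr : 3 ≤ r)
    {c : Fin m × Fin n → Fin r} (hc : Function.Surjective c)
    (h : ¬ (SimpleGraph.pathGraph m □ SimpleGraph.pathGraph n).HasRainbowAP 3 c) :
    ∃ (c' : ℤ → ℤ → Fin r) (α β : ℤ) (R B W : Fin r),
      Banded c' ((m : ℤ) - 1) ((n : ℤ) - 1) α β R B W ∧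
      ∀ i, ∃ x y, InGrid ((m : ℤ) - 1) ((n : ℤ) - 1) x y ∧ c' x y = i := by
  have hm0 : 0 < m := by omega
  have hn0 : 0 < n := by omega
  have hf := rainbowFree_gridVertex hm0 hn0 h
  obtain ⟨u, hu⟩ := hc ⟨0, by omega⟩
  obtain ⟨v, hv⟩ := hc ⟨1, by omega⟩
  obtain ⟨w, hw⟩ := hc ⟨2, by omega⟩
  obtain ⟨α, β, R, B, W, hb | hb⟩ := hf.exists_banded (by omega) (by omega) (inGrid_coe u)
    (inGrid_coe v) (inGrid_coe w) (by simp only [gridVertex_coe, hu, hv]; simp)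
    (by simp only [gridVertex_coe, hv, hw]; simp) (by simp only [gridVertex_coe, hu, hw]; simp)
  · refine ⟨_, α, β, R, B, W, hb, fun i => ?_⟩
    obtain ⟨t, rfl⟩ := hc i
    exact ⟨t.1, t.2, inGrid_coe t, by simp only [gridVertex_coe]⟩
  · refine ⟨_, α, β, R, B, W, hb, fun i => ?_⟩
    obtain ⟨t, rfl⟩ := hc i
    have := inGrid_coe t
    exact ⟨t.1, (n : ℤ) - 1 - t.2, by omega, by simp only [sub_sub_cancel, gridVertex_coe]⟩

lemma hasRainbowAP_of_four {m n : ℕ} (hm : 2 ≤ m) (hn : 2 ≤ n) {c : Fin m × Fin n → Fin 4}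
    (hc : Function.Surjective c) :
    (SimpleGraph.pathGraph m □ SimpleGraph.pathGraph n).HasRainbowAP 3 c := by
  by_contra h
  obtain ⟨c', α, β, R, B, W, hb, hs⟩ :=
    exists_banded_of_not_hasRainbowAP hm hn (by omega) hc h
  have hex : ∀ R B W : Fin 4, ∃ i, i ≠ R ∧ i ≠ B ∧ i ≠ W := by decide
  obtain ⟨i, h1, h2, h3⟩ := hex R B W
  obtain ⟨x, y, hg, rfl⟩ := hs i
  rcases hb.color hg with h | h | h <;> contradiction

lemma hasRainbowAP_of_three {m n : ℕ} (hm : 2 ≤ m) (hn : 2 ≤ n) {c : Fin m × Fin n → Fin 3}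
    (hc : Function.Surjective c)
    (hmn : (m = 2 ∧ Even n) ∨ (n = 2 ∧ Even m) ∨ (m = 3 ∧ Odd n) ∨ (n = 3 ∧ Odd m)) :
    (SimpleGraph.pathGraph m □ SimpleGraph.pathGraph n).HasRainbowAP 3 c := by
  by_contra h
  obtain ⟨c', α, β, R, B, W, hb, -⟩ := exists_banded_of_not_hasRainbowAP hm hn le_rfl hc h
  rcases hmn with ⟨rfl, k, hk⟩ | ⟨rfl, k, hk⟩ | ⟨rfl, k, hk⟩ | ⟨rfl, k, hk⟩
  · exact hb.two_even_false (by norm_num) ⟨k - 1, by omega⟩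
  · exact hb.transpose.two_even_false (by norm_num) ⟨k - 1, by omega⟩
  · exact hb.three_odd_false (by norm_num) ⟨k, by omega⟩
  · exact hb.transpose.three_odd_false (by norm_num) ⟨k, by omega⟩

/-! ### Colourings for the lower bound -/

/-- The colouring with one corner of colour `0`, the antidiagonal `x + y = β` of colour `1`, and
colour `2` elsewhere. -/
def bandColoring (m n β : ℕ) (u : Fin m × Fin n) : Fin 3 :=
  if (u.1 : ℕ) + u.2 = 0 then 0 else if (u.1 : ℕ) + u.2 = β then 1 else 2

lemma bandColoring_surjective {m n β : ℕ} (hm : 2 ≤ m) (hn : 2 ≤ n) (hβ : 2 ≤ β)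
    (hβ' : β ≤ m + n - 2) : Function.Surjective (bandColoring m n β) := by
  intro i
  fin_cases i
  · exact ⟨(⟨0, by omega⟩, ⟨0, by omega⟩), by simp [bandColoring]⟩
  · refine ⟨(⟨min β (m - 1), by omega⟩, ⟨β - min β (m - 1), by omega⟩), ?_⟩
    have h1 : min β (m - 1) + (β - min β (m - 1)) = β := by omega
    have h2 : β ≠ 0 := by omega
    simp [bandColoring, h1, h2]
  · refine ⟨(⟨1, by omega⟩, ⟨0, by omega⟩), ?_⟩
    have h1 : 1 ≠ β := by omega
    simp [bandColoring, h1]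

lemma bandColoring_eq_cases {m n β : ℕ} (u : Fin m × Fin n) :
    (bandColoring m n β u = 0 ∧ (u.1 : ℕ) = 0 ∧ (u.2 : ℕ) = 0) ∨
    (bandColoring m n β u = 1 ∧ (u.1 : ℕ) + u.2 = β) ∨
    (bandColoring m n β u = 2 ∧ (u.1 : ℕ) + u.2 ≠ 0 ∧ (u.1 : ℕ) + u.2 ≠ β) := by
  unfold bandColoring
  split_ifs with h1 h2
  · exact .inl ⟨rfl, by omega, by omega⟩
  · exact .inr (.inl ⟨rfl, h2⟩)
  · exact .inr (.inr ⟨rfl, h1, h2⟩)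

/-- A middle vertex of colour 2 is excluded since `β` is odd, and one of colour 0 since all vertices
at distance `β` from the origin have colour 1. A middle vertex of colour 1 is the opposite corner or
adjacent to it, and only the origin is at distance `β` from it; the adjacent case needs both sides
at least 4. -/
lemma not_hasRainbowAP_bandColoring {m n β : ℕ} (hm : 2 ≤ m) (hn : 2 ≤ n) (hβ : Odd β)
    (hmn : β = m + n - 2 ∨ (β = m + n - 3 ∧ 4 ≤ m ∧ 4 ≤ n)) :
    ¬ (SimpleGraph.pathGraph m □ SimpleGraph.pathGraph n).HasRainbowAP 3
      (bandColoring m n β) := by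
  rw [SimpleGraph.hasRainbowAP_three_iff]
  rintro ⟨u, v, w, hd, h1, h2, h3⟩
  rw [SimpleGraph.dist_boxProd_pathGraph, SimpleGraph.dist_boxProd_pathGraph] at hd
  obtain ⟨k, rfl⟩ := hβ
  have hu := bandColoring_eq_cases (β := 2 * k + 1) u
  have hv := bandColoring_eq_cases (β := 2 * k + 1) v
  have hw := bandColoring_eq_cases (β := 2 * k + 1) w
  obtain ⟨⟨a, ha⟩, ⟨b, hb⟩⟩ := u
  obtain ⟨⟨p, hp⟩, ⟨q, hq⟩⟩ := v
  obtain ⟨⟨x, hx⟩, ⟨y, hy⟩⟩ := w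
  simp only at hd hu hv hw
  rcases hu with ⟨hu, hu'⟩ | ⟨hu, hu'⟩ | ⟨hu, hu'⟩ <;>
  rcases hv with ⟨hv, hv'⟩ | ⟨hv, hv'⟩ | ⟨hv, hv'⟩ <;>
  rcases hw with ⟨hw, hw'⟩ | ⟨hw, hw'⟩ | ⟨hw, hw'⟩ <;>
  rw [hu, hv] at h1 <;> rw [hv, hw] at h2 <;> rw [hu, hw] at h3 <;>
  first
  | exact h1 rfl
  | exact h2 rfl
  | exact h3 rfl
  | (clear hu hv hw h1 h2 h3; omega)

lemma exists_coloring_not_hasRainbowAP {m n : ℕ} (hm : 2 ≤ m) (hn : 2 ≤ n)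
    (hmn : ¬ ((m = 2 ∧ Even n) ∨ (n = 2 ∧ Even m) ∨ (m = 3 ∧ Odd n) ∨ (n = 3 ∧ Odd m))) :
    ∃ c : Fin m × Fin n → Fin 3, Function.Surjective c ∧
      ¬ (SimpleGraph.pathGraph m □ SimpleGraph.pathGraph n).HasRainbowAP 3 c := by
  simp only [Nat.even_iff, Nat.odd_iff] at hmn
  by_cases hpar : (m + n) % 2 = 1
  · exact ⟨bandColoring m n (m + n - 2),
      bandColoring_surjective hm hn (by omega) (by omega),
      not_hasRainbowAP_bandColoring hm hn (Nat.odd_iff.mpr (by omega)) (.inl rfl)⟩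
  · exact ⟨bandColoring m n (m + n - 3),
      bandColoring_surjective hm hn (by omega) (by omega),
      not_hasRainbowAP_bandColoring hm hn (Nat.odd_iff.mpr (by omega))
        (.inr ⟨rfl, by omega, by omega⟩)⟩

/-! ### The value of the anti-van der Waerden number -/

lemma SimpleGraph.three_le_of_forall_hasRainbowAP {V : Type*} (G : SimpleGraph V) {r : ℕ}
    (hr : 0 < r) {c : V → Fin 3} (hc : Function.Surjective c)
    (h : ∀ c : V → Fin r, Function.Surjective c → G.HasRainbowAP 3 c) : 3 ≤ r := by
  by_contra hlt
  -- Merging colours turns the exact 3-colouring into an exact `r`-colouring with too few colours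
  -- for a rainbow triple.
  have hs : Function.Surjective fun i : Fin 3 => (⟨min i (r - 1), by omega⟩ : Fin r) := by
    intro i
    exact ⟨⟨i, by omega⟩, Fin.ext (by simp only; omega)⟩
  obtain ⟨u, v, w, -, h1, h2, h3⟩ :=
    (G.hasRainbowAP_three_iff _).mp (h _ (hs.comp hc))
  rw [Ne, Fin.ext_iff] at h1 h2 h3
  have := (((fun i : Fin 3 => (⟨min i (r - 1), by omega⟩ : Fin r)) ∘ c) u).isLt
  have := (((fun i : Fin 3 => (⟨min i (r - 1), by omega⟩ : Fin r)) ∘ c) v).isLt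
  have := (((fun i : Fin 3 => (⟨min i (r - 1), by omega⟩ : Fin r)) ∘ c) w).isLt
  omega

theorem mainTheorem2 (m n : ℕ) (hm : 2 ≤ m) (hn : 2 ≤ n) :
    (SimpleGraph.pathGraph m □ SimpleGraph.pathGraph n).aw 3 =
      if (m = 2 ∧ Even n) ∨ (n = 2 ∧ Even m) ∨ (m = 3 ∧ Odd n) ∨ (n = 3 ∧ Odd m) then 3
      else 4 := by
  -- Any exact 3-colouring serves here; `β = 2` is available in every grid.
  have hsurj := bandColoring_surjective hm hn le_rfl (by omega)
  unfold SimpleGraph.aw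
  split_ifs with hmn
  · apply IsLeast.csInf_eq
    exact ⟨⟨by omega, fun c hc => hasRainbowAP_of_three hm hn hc hmn⟩,
      fun r hr => SimpleGraph.three_le_of_forall_hasRainbowAP _ hr.1 hsurj hr.2⟩
  · apply IsLeast.csInf_eq
    refine ⟨⟨by omega, fun c hc => hasRainbowAP_of_four hm hn hc⟩, fun r hr => ?_⟩
    have h3 := SimpleGraph.three_le_of_forall_hasRainbowAP _ hr.1 hsurj hr.2
    rcases h3.eq_or_lt with rfl | h4
    · obtain ⟨c, hc, hc'⟩ := exists_coloring_not_hasRainbowAP hm hn hmn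
      exact absurd (hr.2 c hc) hc'
    · exact h4
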